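/- All graphs are finite, simple and connected, and $n$ denotes the number of nodes. The nodes of a graph $G=(V,E)$ carry pairwise distinct identifiers $\mathsf{id}(u)\in\mathbb N$ of $O(\log n)$ bits. A verification algorithm with locality $1$ is a function $\mathcal A$ with values in $\{\mathsf{Accept},\mathsf{Reject}\}$; given a certificate function $c$, which assigns a bit string $c(u)$ to every node $u$, the output of $u$ is the value of $\mathcal A$ on $(\mathsf{id}(u),c(u))$ and the set $\{(\mathsf{id}(v),c(v)) : v \text{ a neighbor of } u\}$. A graph is $P_5$-free if it does not contain the path on $5$ nodes as an induced subgraph. **Theorem.** There is a proof-labeling scheme with locality $1$ that certifies $P_5$-freeness with certificates of size $O(n\log n)$. That is, there is a verification algorithm $\mathcal A$ with locality $1$ such that for every function $b:\mathbb N\to\mathbb N$ with $b(n)=O(\log n)$ there is a function $s:\mathbb N\to\mathbb N$ with $s(n)=O(n\log n)$ such that the following holds for every connected graph $G$ on $n$ nodes and every assignment of pairwise distinct identifiers of at most $b(n)$ bits to its nodes: - if $G$ is $P_5$-free, then there is a certificate function $c$ with $|c(u)|=s(n)$ for all nodes $u$ such that all nodes output $\mathsf{Accept}$; - if $G$ is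 not $P_5$-free, then for every certificate function $c$ at least one node outputs $\mathsf{Reject}$. -/

import Mathlib

open Filter Asymptotics

namespace LocalCert

/-- A verification algorithm: given the identifier and the certificate of a node, and the set of
pairs (identifier, certificate) of the other nodes that it sees, it outputs accept (`true`) or
reject (`false`). -/
abbrev Verifier : Type := ℕ → List Bool → Finset (ℕ × List Bool) → Bool

/-- The pairs (identifier, certificate) of the `ℓ`-hop neighbors of `u`, i.e. of the nodes
`v ≠ u` at distance at most `ℓ` from `u` (nodes that are not reachable from `u` have
`G.dist u v = 0`, and so does `u` itself). -/
noncomputable def view {V : Type} [Fintype V] (ℓ : ℕ) (G : SimpleGraph V) (ident : V → ℕ)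
    (c : V → List Bool) (u : V) : Finset (ℕ × List Bool) := by
  classical
  exact (Finset.univ.filter fun v => 0 < G.dist u v ∧ G.dist u v ≤ ℓ).image
    fun v => (ident v, c v)

/-- The node `u` accepts when `A` is run with locality `ℓ`. -/
def Accepts {V : Type} [Fintype V] (A : Verifier) (ℓ : ℕ) (G : SimpleGraph V) (ident : V → ℕ)
    (c : V → List Bool) (u : V) : Prop :=
  A (ident u) (c u) (view ℓ G ident c u) = true

/-- The verifier `A` with locality `ℓ` certifies the property `P` on connected graphs, with
certificates of `s n` bits, when the `n` nodes have distinct identifiers of at most `b n` bits: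
if `G` satisfies `P`, some assignment of certificates of `s n` bits makes all nodes accept; if `G`
does not satisfy `P`, every assignment of certificates (of whatever lengths) makes some node
reject. -/
def Certifies (A : Verifier) (ℓ : ℕ) (P : ∀ {V : Type}, SimpleGraph V → Prop)
    (b s : ℕ → ℕ) : Prop :=
  ∀ (V : Type) [Fintype V] (G : SimpleGraph V) (ident : V → ℕ),
    G.Connected → Function.Injective ident →
    (∀ u, (ident u).size ≤ b (Fintype.card V)) →
      (P G → ∃ c : V → List Bool, (∀ u, (c u).length = s (Fintype.card V)) ∧
        ∀ u, Accepts A ℓ G ident c u) ∧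
      (¬ P G → ∀ c : V → List Bool, ∃ u, ¬ Accepts A ℓ G ident c u)

/-- `G` has no induced path on `k` nodes. -/
def PathFree (k : ℕ) {V : Type} (G : SimpleGraph V) : Prop :=
  ¬ (SimpleGraph.pathGraph k).IsIndContained G

/-- There is a proof-labeling scheme with locality `ℓ` that certifies `P` with certificates of
size `O(f n)`: there is one verifier that works for all graphs and all identifiers, and whenever
the identifiers have `O(log n)` bits, certificates of `O(f n)` bits suffice. -/
def HasPLS (ℓ : ℕ) (P : ∀ {V : Type}, SimpleGraph V → Prop) (f : ℕ → ℝ) : Prop :=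
  ∃ A : Verifier, ∀ b : ℕ → ℕ, (fun n => (b n : ℝ)) =O[atTop] (fun n : ℕ => Real.log n) →
    ∃ s : ℕ → ℕ, (fun n => (s n : ℝ)) =O[atTop] f ∧ Certifies A ℓ P b s

end LocalCert

/-!
Call `a, b, c, d, e` an almost path if it is an induced path on five nodes, except that `a` and `d`
may be adjacent or `a` may be equal to `c`. The induced paths on five nodes are the almost paths
without the chord `ad`, so their number is the sum over the nodes `v` of the number of almost paths
with second node `v` minus the number of those with the chord `ad` and fourth node `v`.

Each of these terms can be computed at `v` if the certificate of every node lists its neighbors and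
the number of neighbors that it shares with each node. In an almost path `a, v, c, d, e`, the node
`d` is not seen by `v`, but it matters only as a common neighbor of `c` and `e`; in an almost path
`a, b, c, v, e` with the chord `av`, the node `b` is not seen by `v`, but it matters only as a
common neighbor of `a` and `c`. The listed data can be checked locally.

It remains to certify that the terms add up to zero. On a connected graph, a function on the nodes
has sum zero if and only if it is the divergence of a flow along the edges, so it suffices to store
such a flow in the certificates. A certificate then consists of `O(n)` numbers, all of which are
polynomially bounded.
-/

namespace LocalCert

open scoped Finset

section Flow

variable {V M : Type*} (G : SimpleGraph V)

/-- The net amount leaving each node when `φ x y` is sent from `x` to `y` along every edge `xy` of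
`G`; the values of `φ` at non-adjacent pairs do not matter. -/
def divergence [AddCommGroup M] [G.LocallyFinite] : (V → V → M) →+ (V → M) where
  toFun φ x := ∑ y ∈ G.neighborFinset x, (φ x y - φ y x)
  map_zero' := by ext; simp
  map_add' φ ψ := by ext; simp only [Pi.add_apply, add_sub_add_comm, Finset.sum_add_distrib]

theorem divergence_apply [AddCommGroup M] [G.LocallyFinite] (φ : V → V → M) (x : V) :
    divergence G φ x = ∑ y ∈ G.neighborFinset x, (φ x y - φ y x) := rfl

theorem sum_divergence [AddCommGroup M] [Fintype V] [G.LocallyFinite] (φ : V → V → M) :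
    ∑ x, divergence G φ x = 0 := by
  simp only [divergence_apply, Finset.sum_sub_distrib, sub_eq_zero]
  exact Finset.sum_comm' (by simp [G.adj_comm])

variable {G} {u v r : V}

theorem divergence_single [AddCommGroup M] [G.LocallyFinite] [DecidableEq V] (h : G.Adj u v)
    (m : M) :
    divergence G (Pi.single u (Pi.single v m)) = Pi.single u m - Pi.single v m := by
  ext x
  rcases eq_or_ne x u with rfl | hu <;> rcases eq_or_ne x v with rfl | hv <;>
    simp_all [divergence_apply, Pi.single_apply, h.symm, G.adj_comm, ite_apply]

/-- The flow that sends the amount `m` along every dart of a walk. -/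
def walkFlow [AddCommGroup M] [DecidableEq V] (W : G.Walk u r) (m : M) (x y : V) : M :=
  (W.darts.map (·.toProd)).count (x, y) • m

theorem walkFlow_cons [AddCommGroup M] [DecidableEq V] (h : G.Adj u v) (W : G.Walk v r) (m : M) :
    walkFlow (.cons h W) m = Pi.single u (Pi.single v m) + walkFlow W m := by
  ext x y
  rcases eq_or_ne x u with rfl | hu <;> rcases eq_or_ne y v with rfl | hv <;>
    simp_all [walkFlow, add_smul, add_comm, eq_comm]

theorem divergence_walkFlow [AddCommGroup M] [G.LocallyFinite] [DecidableEq V] (W : G.Walk u r)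
    (m : M) : divergence G (walkFlow W m) = Pi.single u m - Pi.single r m := by
  induction W with
  | nil => ext; simp [divergence_apply, walkFlow]
  | cons h W ih => rw [walkFlow_cons, map_add, divergence_single h, ih, sub_add_sub_cancel]

variable [AddCommGroup M] [LinearOrder M] [IsOrderedAddMonoid M]

theorem abs_walkFlow_le [DecidableEq V] {W : G.Walk u r} (hW : W.IsPath) (m : M) (x y : V) :
    |walkFlow W m x y| ≤ |m| := by
  have hcount : (W.darts.map (·.toProd)).count (x, y) ≤ 1 :=
    List.nodup_iff_count_le_one.1 ((SimpleGraph.Walk.darts_nodup_of_support_nodup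
      hW.support_nodup).map SimpleGraph.Dart.toProd_injective) _
  calc |walkFlow W m x y| = (W.darts.map (·.toProd)).count (x, y) • |m| := abs_nsmul _ _
    _ ≤ 1 • |m| := nsmul_le_nsmul_left (abs_nonneg m) hcount
    _ = |m| := one_nsmul _

theorem exists_divergence_eq [Fintype V] [G.LocallyFinite] (hG : G.Connected) {f : V → M}
    (hf : ∑ u, f u = 0) :
    ∃ φ : V → V → M, divergence G φ = f ∧ ∀ x y, |φ x y| ≤ ∑ u, |f u| := by
  classical
  obtain ⟨r⟩ := hG.nonempty
  choose W hW using fun u => (hG.preconnected u r).exists_isPath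
  refine ⟨∑ u, walkFlow (W u) (f u), ?_, fun x y => ?_⟩
  · have hroot : ∑ u, Pi.single r (f u) = (0 : V → M) := by
      rw [← Pi.single_zero r, ← hf]
      exact (map_sum (AddMonoidHom.single (fun _ => M) r) f _).symm
    simp only [map_sum, divergence_walkFlow, Finset.sum_sub_distrib, hroot, sub_zero,
      Finset.univ_sum_single]
  · simp only [Finset.sum_apply]
    exact (Finset.abs_sum_le_sum_abs _ _).trans
      (Finset.sum_le_sum fun u _ => abs_walkFlow_le (hW u) _ x y)

end Flow

section InducedPaths

variable {V : Type*} (G : SimpleGraph V)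

/-- `a, b, c, d, e` is an induced path, except that `a` and `d` may be adjacent or `a` may be equal
to `c` (in which case `a` and `d` are adjacent). -/
def IsAlmostPath (a b c d e : V) : Prop :=
  (G.Adj a b ∧ G.Adj b c ∧ G.Adj c d ∧ G.Adj d e) ∧
    ¬ G.Adj a c ∧ ¬ G.Adj a e ∧ ¬ G.Adj b d ∧ ¬ G.Adj b e ∧ ¬ G.Adj c e

instance [DecidableRel G.Adj] (a b c d e : V) : Decidable (IsAlmostPath G a b c d e) :=
  inferInstanceAs (Decidable (_ ∧ _))

variable {G}

theorem isIndContained_pathGraph_five_iff :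
    (SimpleGraph.pathGraph 5).IsIndContained G ↔
      ∃ a b c d e, IsAlmostPath G a b c d e ∧ ¬ G.Adj a d := by
  constructor
  · rintro ⟨p⟩
    have hadj (i j : Fin 5) : G.Adj (p i) (p j) ↔ i.val + 1 = j.val ∨ j.val + 1 = i.val := by
      rw [p.map_rel_iff, SimpleGraph.pathGraph_adj]
    refine ⟨p 0, p 1, p 2, p 3, p 4, ?_⟩
    simp only [IsAlmostPath, hadj]
    decide
  · rintro ⟨a, b, c, d, e, ⟨⟨hab, hbc, hcd, hde⟩, hac, hae, hbd, hbe, hce⟩, had⟩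
    have hadj (i j : Fin 5) : G.Adj (![a, b, c, d, e] i) (![a, b, c, d, e] j) ↔
        (SimpleGraph.pathGraph 5).Adj i j := by
      rw [SimpleGraph.pathGraph_adj]
      fin_cases i <;> fin_cases j <;> simp [*, G.adj_comm]
    -- Distinct nodes of the path on five nodes have distinct neighborhoods.
    have hinj : Function.Injective ![a, b, c, d, e] := by
      intro i j hij
      have hnbrs (k : Fin 5) :
          (SimpleGraph.pathGraph 5).Adj i k ↔ (SimpleGraph.pathGraph 5).Adj j k := by
        rw [← hadj, ← hadj, hij]
      simp only [SimpleGraph.pathGraph_adj] at hnbrs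
      clear hij
      decide +revert
    exact ⟨⟨⟨_, hinj⟩, hadj _ _⟩⟩

variable [Fintype V] [DecidableEq V] (G) [DecidableRel G.Adj]

/-- The tuples `(a, b, c, d, e)` with `IsAlmostPath G a b c d e`. -/
def almostPaths : Finset (V × V × V × V × V) :=
  {p | IsAlmostPath G p.1 p.2.1 p.2.2.1 p.2.2.2.1 p.2.2.2.2}

/-- The almost paths that are not induced paths: `a, b, c, d` is a cycle of length four, possibly
degenerate, and `e` is pendant at `d`. -/
def pendantCycles : Finset (V × V × V × V × V) :=
  {p ∈ almostPaths G | G.Adj p.1 p.2.2.2.1}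

/-- The contribution of `v` to the number of induced paths on five nodes: an almost path is counted
at its second node, and a pendant cycle is discounted at its fourth node. -/
def pathCountAt (v : V) : ℤ :=
  #{p ∈ almostPaths G | p.2.1 = v} - #{p ∈ pendantCycles G | p.2.2.2.1 = v}

theorem sum_pathCountAt :
    ∑ v, pathCountAt G v = #{p ∈ almostPaths G | ¬ G.Adj p.1 p.2.2.2.1} := by
  have hsplit := Finset.card_filter_add_card_filter_not (s := almostPaths G)
    fun p => G.Adj p.1 p.2.2.2.1
  simp only [pathCountAt, Finset.sum_sub_distrib, ← Nat.cast_sum]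
  rw [← Finset.card_eq_sum_card_fiberwise fun _ _ => Finset.mem_coe.2 (Finset.mem_univ _),
    ← Finset.card_eq_sum_card_fiberwise fun _ _ => Finset.mem_coe.2 (Finset.mem_univ _), ← hsplit,
    pendantCycles, Nat.cast_add, add_sub_cancel_left]

theorem pathFree_five_iff_sum_pathCountAt_eq_zero {V : Type} [Fintype V] [DecidableEq V]
    (G : SimpleGraph V) [DecidableRel G.Adj] :
    PathFree 5 G ↔ ∑ v, pathCountAt G v = 0 := by
  rw [sum_pathCountAt, Nat.cast_eq_zero, Finset.card_eq_zero, PathFree,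
    isIndContained_pathGraph_five_iff]
  simp [Finset.eq_empty_iff_forall_notMem, almostPaths]

theorem abs_pathCountAt_le (v : V) : |pathCountAt G v| ≤ (Fintype.card V : ℤ) ^ 5 := by
  have hcard (s : Finset (V × V × V × V × V)) : (#s : ℤ) ≤ (Fintype.card V : ℤ) ^ 5 := by
    refine mod_cast (Finset.card_le_univ s).trans_eq ?_
    simp only [Fintype.card_prod]
    ring
  exact abs_sub_le_of_nonneg_of_le (Nat.cast_nonneg _) (hcard _) (Nat.cast_nonneg _) (hcard _)

theorem card_almostPaths_filter (v : V) :
    #{p ∈ almostPaths G | p.2.1 = v} =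
      ∑ a ∈ G.neighborFinset v, ∑ c ∈ G.neighborFinset v with ¬ G.Adj c a,
        ∑ d ∈ G.neighborFinset c \ G.neighborFinset v, #(G.neighborFinset d \
          (G.neighborFinset a ∪ G.neighborFinset v ∪ G.neighborFinset c)) := by
  simp only [← Finset.card_sigma]
  refine Finset.card_nbij' (fun p => ⟨p.1, p.2.2.1, p.2.2.2.1, p.2.2.2.2⟩)
    (fun q => (q.1, v, q.2.1, q.2.2.1, q.2.2.2)) ?_ ?_ ?_ ?_
  · rintro ⟨a, b, c, d, e⟩
    simp only [almostPaths, IsAlmostPath, Finset.mem_coe, Finset.mem_sigma, Finset.mem_filter,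
      Finset.mem_sdiff, Finset.mem_union, SimpleGraph.mem_neighborFinset]
    grind [G.adj_comm]
  · rintro ⟨a, c, d, e⟩
    simp only [almostPaths, IsAlmostPath, Finset.mem_coe, Finset.mem_sigma, Finset.mem_filter,
      Finset.mem_sdiff, Finset.mem_union, SimpleGraph.mem_neighborFinset]
    grind [G.adj_comm]
  · rintro ⟨a, b, c, d, e⟩
    simp +contextual
  · rintro ⟨a, c, d, e⟩
    simp

theorem card_pendantCycles_filter (v : V) :
    #{p ∈ pendantCycles G | p.2.2.2.1 = v} =
      ∑ a ∈ G.neighborFinset v, ∑ c ∈ G.neighborFinset v with ¬ G.Adj c a,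
        ∑ e ∈ G.neighborFinset v \ (G.neighborFinset a ∪ G.neighborFinset c),
          #((G.neighborFinset a ∩ G.neighborFinset c) \
            (G.neighborFinset v ∪ G.neighborFinset e)) := by
  simp only [← Finset.card_sigma]
  refine Finset.card_nbij' (fun p => ⟨p.1, p.2.2.1, p.2.2.2.2, p.2.1⟩)
    (fun q => (q.1, q.2.2.2, q.2.1, v, q.2.2.1)) ?_ ?_ ?_ ?_
  · rintro ⟨a, b, c, d, e⟩
    simp only [pendantCycles, almostPaths, IsAlmostPath, Finset.mem_coe, Finset.mem_sigma,
      Finset.mem_filter, Finset.mem_sdiff, Finset.mem_union, Finset.mem_inter,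
      SimpleGraph.mem_neighborFinset]
    grind [G.adj_comm]
  · rintro ⟨a, c, e, b⟩
    simp only [pendantCycles, almostPaths, IsAlmostPath, Finset.mem_coe, Finset.mem_sigma,
      Finset.mem_filter, Finset.mem_sdiff, Finset.mem_union, Finset.mem_inter,
      SimpleGraph.mem_neighborFinset]
    grind [G.adj_comm]
  · rintro ⟨a, b, c, d, e⟩
    simp +contextual
  · rintro ⟨a, c, e, b⟩
    simp

end InducedPaths

section Tables

/-- An entry of the table written in a certificate. In the table of a node `v` there is one row for
every node `u`, with the identifier of `u`, whether `u` is a neighbor of `v`, the number of common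
neighbors of `u` and `v`, and the flow from `v` to `u`. -/
structure Row where
  ident : ℕ
  isNbr : Bool
  codeg : ℕ
  flow : ℤ
deriving DecidableEq

/-- The set of identifiers of the neighbors listed in a table. -/
def nbrs (T : List Row) : Finset ℕ :=
  ((T.filter Row.isNbr).map Row.ident).toFinset

/-- The multiset of identifiers of the end points of the walks of length two, recovered from the
numbers of common neighbors. -/
def twoWalks (T : List Row) : Multiset ℕ :=
  (T.map fun r => r.codeg • ({r.ident} : Multiset ℕ)).sum

/-- The flow to the node with identifier `x` according to a table. -/
def flowTo (T : List Row) (x : ℕ) : ℤ :=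
  (T.map fun r => if r.ident = x then r.flow else 0).sum

/-- The number of almost paths `a, v, c, d, e` as computed at `v` from its table `T` and the set `S`
of labels of its neighbors. For fixed `a` and `c`, the walks `c, d, e` with `e` non-adjacent to `a`,
`v` and `c` are counted by `twoWalks`, as `v` does not see the nodes `d`; the walks in which `d` is
a neighbor of `v` are then subtracted. -/
def localAlmostPathCount (T : List Row) (S : Finset (ℕ × List Row)) : ℤ :=
  ∑ a ∈ S, ∑ c ∈ S with a.1 ∉ nbrs c.2,
    ((twoWalks c.2).countP (· ∉ nbrs a.2 ∪ nbrs T ∪ nbrs c.2) -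
      ∑ d ∈ S with d.1 ∈ nbrs c.2, #(nbrs d.2 \ (nbrs a.2 ∪ nbrs T ∪ nbrs c.2)))

/-- The number of pendant cycles `a, b, c, v, e` as computed at `v` from its table `T` and the set
`S` of labels of its neighbors. -/
def localPendantCycleCount (T : List Row) (S : Finset (ℕ × List Row)) : ℤ :=
  ∑ a ∈ S, ∑ c ∈ S with a.1 ∉ nbrs c.2, ∑ e ∈ S with e.1 ∉ nbrs a.2 ∪ nbrs c.2,
    #((nbrs a.2 ∩ nbrs c.2) \ (nbrs T ∪ nbrs e.2))

/-- The test performed by a node with identifier `i` and table `T` that sees the labels `S` of its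
neighbors: the listed neighbors and walks of length two are the true ones, and the net flow leaving
the node is its contribution to the number of induced paths on five nodes. -/
def Check (i : ℕ) (T : List Row) (S : Finset (ℕ × List Row)) : Prop :=
  nbrs T = S.image Prod.fst ∧
    twoWalks T = ∑ w ∈ S, (nbrs w.2).val ∧
    ∑ w ∈ S, (flowTo T w.1 - flowTo w.2 i) = localAlmostPathCount T S - localPendantCycleCount T S

instance (i : ℕ) (T : List Row) (S : Finset (ℕ × List Row)) : Decidable (Check i T S) :=
  inferInstanceAs (Decidable (_ ∧ _))

theorem countP_sum_val {ι α : Type*} [DecidableEq α] (s : Finset ι) (t : ι → Finset α)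
    (X : Finset α) : (∑ i ∈ s, (t i).val).countP (· ∉ X) = ∑ i ∈ s, #(t i \ X) := by
  rw [← Multiset.coe_countPAddMonoidHom, map_sum]
  simp only [Multiset.coe_countPAddMonoidHom, Finset.sdiff_eq_filter,
    Multiset.countP_eq_card_filter]
  rfl

end Tables

section Verification

/-- The embedding of the nodes into the pairs (identifier, label) for a labeling `lab`, by which the
labels that a node sees are the image of its neighborhood. -/
def withLabel {V Λ : Type*} (ident : V ↪ ℕ) (lab : V → Λ) : V ↪ ℕ × Λ :=
  ⟨fun v => (ident v, lab v), fun _ _ h => ident.injective (Prod.ext_iff.1 h).1⟩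

@[simp]
theorem withLabel_apply {V Λ : Type*} (ident : V ↪ ℕ) (lab : V → Λ) (v : V) :
    withLabel ident lab v = (ident v, lab v) := rfl

theorem view_one {V : Type} [Fintype V] (G : SimpleGraph V) [DecidableRel G.Adj] (ident : V ↪ ℕ)
    (c : V → List Bool) (u : V) :
    view 1 G ident c u = (G.neighborFinset u).map (withLabel ident c) := by
  have hadj (v : V) : 0 < G.dist u v ∧ G.dist u v ≤ 1 ↔ G.Adj u v := by
    rw [← SimpleGraph.dist_eq_one_iff_adj]
    omega
  ext
  simp [view, hadj]

variable {V : Type*} [Fintype V] [DecidableEq V] {G : SimpleGraph V} [DecidableRel G.Adj]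
  {ident : V ↪ ℕ} {T : V → List Row}

theorem localAlmostPathCount_eq (hnbrs : ∀ v, nbrs (T v) = (G.neighborFinset v).map ident)
    (hwalks : ∀ v, twoWalks (T v) = ∑ w ∈ G.neighborFinset v, (nbrs (T w)).val) (v : V) :
    localAlmostPathCount (T v) ((G.neighborFinset v).map (withLabel ident T)) =
      #{p ∈ almostPaths G | p.2.1 = v} := by
  rw [card_almostPaths_filter]
  push_cast
  simp only [localAlmostPathCount, Finset.filter_map, Finset.sum_map, hwalks, countP_sum_val, hnbrs,
    Function.comp_def, withLabel_apply, Finset.mem_map', SimpleGraph.mem_neighborFinset,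
    ← Finset.map_union, ← Finset.map_sdiff, Finset.card_map]
  refine Finset.sum_congr rfl fun a _ => Finset.sum_congr rfl fun c _ => ?_
  simp only [← SimpleGraph.mem_neighborFinset G c, Finset.filter_mem_eq_inter]
  rw [Finset.inter_comm, sub_eq_iff_eq_add']
  push_cast
  exact (Finset.sum_inter_add_sum_sdiff ..).symm

theorem localPendantCycleCount_eq (hnbrs : ∀ v, nbrs (T v) = (G.neighborFinset v).map ident)
    (v : V) :
    localPendantCycleCount (T v) ((G.neighborFinset v).map (withLabel ident T)) =
      #{p ∈ pendantCycles G | p.2.2.2.1 = v} := by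
  rw [card_pendantCycles_filter]
  push_cast
  simp only [localPendantCycleCount, Finset.filter_map, Finset.sum_map, hnbrs,
    Function.comp_def, withLabel_apply, Finset.mem_map', SimpleGraph.mem_neighborFinset,
    ← Finset.map_union, ← Finset.map_inter, Finset.card_map, Finset.sdiff_eq_filter]

theorem forall_check_iff :
    (∀ v, Check (ident v) (T v) ((G.neighborFinset v).map (withLabel ident T))) ↔
      (∀ v, nbrs (T v) = (G.neighborFinset v).map ident) ∧
      (∀ v, twoWalks (T v) = ∑ w ∈ G.neighborFinset v, (nbrs (T w)).val) ∧
      divergence G (fun x y => flowTo (T x) (ident y)) = pathCountAt G := by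
  have hfst (v : V) : ((G.neighborFinset v).map (withLabel ident T)).image Prod.fst =
      (G.neighborFinset v).map ident := by
    simp [Finset.map_eq_image, Finset.image_image, Function.comp_def]
  simp only [Check, hfst, Finset.sum_map, withLabel_apply, forall_and, funext_iff, pathCountAt,
    divergence_apply]
  refine and_congr_right fun hnbrs => and_congr_right fun hwalks => forall_congr' fun v => ?_
  rw [localAlmostPathCount_eq hnbrs hwalks, localPendantCycleCount_eq hnbrs]

theorem pathFree_of_forall_check {V : Type} [Fintype V] {G : SimpleGraph V} [DecidableRel G.Adj]
    {ident : V ↪ ℕ} {T : V → List Row}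
    (h : ∀ v, Check (ident v) (T v) ((G.neighborFinset v).map (withLabel ident T))) :
    PathFree 5 G := by
  classical
  rw [pathFree_five_iff_sum_pathCountAt_eq_zero, ← (forall_check_iff.1 h).2.2, sum_divergence]

variable (G) in
/-- The table of `v` in an accepting assignment of certificates for the edge flow `φ`. -/
noncomputable def honestTable (ident : V ↪ ℕ) (φ : V → V → ℤ) (v : V) : List Row :=
  Finset.univ.toList.map fun u =>
    ⟨ident u, decide (G.Adj v u), #(G.neighborFinset v ∩ G.neighborFinset u), φ v u⟩

theorem nbrs_honestTable (φ : V → V → ℤ) (v : V) :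
    nbrs (honestTable G ident φ v) = (G.neighborFinset v).map ident := by
  ext x
  simp [nbrs, honestTable]

theorem twoWalks_honestTable (φ : V → V → ℤ) (v : V) :
    twoWalks (honestTable G ident φ v) =
      ∑ w ∈ G.neighborFinset v, ((G.neighborFinset w).map ident).val := by
  calc twoWalks (honestTable G ident φ v)
      = ∑ u, ∑ w ∈ G.neighborFinset v ∩ G.neighborFinset u, {ident u} := by
        simp [twoWalks, honestTable, Function.comp_def]
    _ = ∑ w ∈ G.neighborFinset v, ∑ u ∈ G.neighborFinset w, {ident u} :=
        Finset.sum_comm' (by simp [G.adj_comm, and_comm])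
    _ = _ := by simp [← Finset.sum_multiset_singleton]

theorem flowTo_honestTable (φ : V → V → ℤ) (v u : V) :
    flowTo (honestTable G ident φ v) (ident u) = φ v u := by
  simp [flowTo, honestTable, Function.comp_def, ident.injective.eq_iff]

theorem check_honestTable {φ : V → V → ℤ} (hφ : divergence G φ = pathCountAt G) (v : V) :
    Check (ident v) (honestTable G ident φ v)
      ((G.neighborFinset v).map (withLabel ident (honestTable G ident φ))) := by
  revert v
  simp only [forall_check_iff, nbrs_honestTable, twoWalks_honestTable, flowTo_honestTable, hφ,
    implies_true, and_self]

end Verification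

section Encoding

/-- The encoding of a number in certificates: `true, b` is a binary digit `b`, starting with the
least significant one, and `false, true` ends the number. -/
def encodeNat (k : ℕ) : List Bool :=
  k.bits.flatMap (fun b => [true, b]) ++ [false, true]

/-- The list of numbers encoded by a bit string. The first pair that does not follow the format of
`encodeNat` ends the list, which allows padding with `false`. -/
def decodeNats : List Bool → List ℕ
  | true :: b :: l =>
    match decodeNats l with
    | [] => []
    | x :: xs => Nat.bit b x :: xs
  | false :: true :: l => 0 :: decodeNats l
  | _ => []

theorem length_encodeNat (k : ℕ) : (encodeNat k).length = 2 * k.size + 2 := by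
  simp [encodeNat, Nat.size_eq_bits_len, mul_comm]

theorem decodeNats_encodeNat_append (k : ℕ) (l : List Bool) :
    decodeNats (encodeNat k ++ l) = k :: decodeNats l := by
  induction k using Nat.binaryRec' with
  | zero => simp [encodeNat, decodeNats]
  | bit b k hk ih =>
    have hcons : encodeNat (Nat.bit b k) = true :: b :: encodeNat k := by
      simp [encodeNat, Nat.bits_append_bit k b hk]
    simp only [hcons, List.cons_append, decodeNats, ih]

theorem decodeNats_replicate_false : ∀ k : ℕ, decodeNats (List.replicate k false) = []
  | 0 | 1 | _ + 2 => rfl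

theorem exists_decodeNats_eq {xs : List ℕ} {m s : ℕ} (hm : ∀ x ∈ xs, x.size ≤ m)
    (hs : (2 * m + 2) * xs.length ≤ s) :
    ∃ w : List Bool, w.length = s ∧ decodeNats w = xs := by
  induction xs generalizing s with
  | nil => exact ⟨.replicate s false, List.length_replicate, decodeNats_replicate_false s⟩
  | cons x xs ih =>
    obtain ⟨hx, hxs⟩ := List.forall_mem_cons.1 hm
    rw [List.length_cons, mul_add_one] at hs
    obtain ⟨w, hw, hdecode⟩ := ih hxs (s := s - (2 * x.size + 2)) (by omega)
    refine ⟨encodeNat x ++ w, ?_, by rw [decodeNats_encodeNat_append, hdecode]⟩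
    rw [List.length_append, length_encodeNat, hw]
    omega

/-- The encoding of a row by five numbers; the flow is given by its positive and negative parts. -/
def Row.toNats (r : Row) : List ℕ :=
  [r.ident, r.isNbr.toNat, r.codeg, r.flow.toNat, (-r.flow).toNat]

/-- The table encoded by a list of numbers, a left inverse of `List.flatMap Row.toNats`. -/
def rowsOfNats : List ℕ → List Row
  | i :: j :: k :: p :: q :: l => ⟨i, j != 0, k, p - q⟩ :: rowsOfNats l
  | _ => []

theorem rowsOfNats_flatMap_toNats (T : List Row) : rowsOfNats (T.flatMap Row.toNats) = T := by
  induction T with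
  | nil => rfl
  | cons r T ih =>
    have hbool : (r.isNbr.toNat != 0) = r.isNbr := by cases r.isNbr <;> rfl
    simp only [List.flatMap_cons, Row.toNats, List.cons_append, List.nil_append, rowsOfNats, hbool,
      Int.toNat_sub_toNat_neg, ih]

/-- The table encoded by a certificate. -/
def tableOfBits (w : List Bool) : List Row :=
  rowsOfNats (decodeNats w)

theorem exists_tableOfBits_eq {T : List Row} {m s : ℕ} (hm : ∀ r ∈ T, ∀ x ∈ r.toNats, x.size ≤ m)
    (hs : (2 * m + 2) * (5 * T.length) ≤ s) :
    ∃ w : List Bool, w.length = s ∧ tableOfBits w = T := by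
  have hlength : (T.flatMap Row.toNats).length = 5 * T.length := by
    simp [List.length_flatMap, Row.toNats, mul_comm]
  obtain ⟨w, hw, hdecode⟩ := exists_decodeNats_eq (List.forall_mem_flatMap.2 hm) (hlength ▸ hs)
  exact ⟨w, hw, by rw [tableOfBits, hdecode, rowsOfNats_flatMap_toNats]⟩

end Encoding

section Scheme

/-- The verification algorithm for `P₅`-freeness. -/
def pathVerifier : Verifier := fun i c S =>
  decide (Check i (tableOfBits c) (S.image (Prod.map id tableOfBits)))

theorem accepts_pathVerifier_iff {V : Type} [Fintype V] {G : SimpleGraph V} [DecidableRel G.Adj]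
    {ident : V ↪ ℕ} {c : V → List Bool} {u : V} :
    Accepts pathVerifier 1 G ident c u ↔ Check (ident u) (tableOfBits (c u))
      ((G.neighborFinset u).map (withLabel ident (tableOfBits ∘ c))) := by
  rw [Accepts, view_one, pathVerifier, decide_eq_true_iff, Finset.map_eq_image, Finset.image_image,
    Finset.map_eq_image]
  rfl

theorem size_pow_le (n : ℕ) {k : ℕ} (hk : k ≠ 0) : (n ^ k).size ≤ k * n.size := by
  rw [Nat.size_le, mul_comm, pow_mul]
  exact Nat.pow_lt_pow_left n.lt_size_self hk

/-- A bound on the size of the encoding of a table of `n` rows, if the identifiers have at most `b`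
bits and the other entries are at most `n ^ 6`. -/
def certificateLength (b n : ℕ) : ℕ :=
  (2 * (b + 6 * n.size) + 2) * (5 * n)

theorem size_le_of_mem_toNats {r : Row} {b n : ℕ} (hident : r.ident.size ≤ b) (hn : 0 < n)
    (hcodeg : r.codeg ≤ n) (hflow : |r.flow| ≤ (n : ℤ) ^ 6) {x : ℕ} (hx : x ∈ r.toNats) :
    x.size ≤ b + 6 * n.size := by
  have hbound {y : ℕ} (hy : y ≤ n ^ 6) : y.size ≤ b + 6 * n.size :=
    ((Nat.size_le_size hy).trans (size_pow_le n (by norm_num))).trans (Nat.le_add_left _ _)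
  obtain ⟨hneg, hpos⟩ := abs_le.1 hflow
  simp only [Row.toNats, List.mem_cons, List.not_mem_nil, or_false] at hx
  rcases hx with rfl | rfl | rfl | rfl | rfl
  · exact hident.trans (Nat.le_add_right _ _)
  · exact hbound (r.isNbr.toNat_le.trans (Nat.one_le_pow _ _ hn))
  · exact hbound (hcodeg.trans (Nat.le_self_pow (by norm_num) n))
  · exact hbound (Int.toNat_le.2 (mod_cast hpos))
  · exact hbound (Int.toNat_le.2 (by push_cast; linarith))

theorem exists_certificates_of_pathFree {V : Type} [Fintype V] {G : SimpleGraph V}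
    {ident : V ↪ ℕ} {b : ℕ} (hG : G.Connected) (hident : ∀ u, (ident u).size ≤ b)
    (hfree : PathFree 5 G) :
    ∃ c : V → List Bool, (∀ u, (c u).length = certificateLength b (Fintype.card V)) ∧
      ∀ u, Accepts pathVerifier 1 G ident c u := by
  classical
  obtain ⟨φ, hφ, hle⟩ :=
    exists_divergence_eq hG ((pathFree_five_iff_sum_pathCountAt_eq_zero G).1 hfree)
  have hflow (x y : V) : |φ x y| ≤ (Fintype.card V : ℤ) ^ 6 :=
    calc |φ x y| ≤ ∑ u, |pathCountAt G u| := hle x y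
      _ ≤ ∑ _ : V, (Fintype.card V : ℤ) ^ 5 := Finset.sum_le_sum fun u _ => abs_pathCountAt_le G u
      _ = (Fintype.card V : ℤ) ^ 6 := by simp [← pow_succ']
  have hsize (v : V) : ∀ r ∈ honestTable G ident φ v, ∀ x ∈ r.toNats,
      x.size ≤ b + 6 * (Fintype.card V).size := by
    intro r hr x
    obtain ⟨u, -, rfl⟩ := List.mem_map.1 hr
    exact size_le_of_mem_toNats (hident u) (Fintype.card_pos_iff.2 ⟨v⟩) (Finset.card_le_univ _)
      (hflow v u)
  choose c hlength hc using fun v => exists_tableOfBits_eq (hsize v)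
    (s := certificateLength b (Fintype.card V)) (by simp [honestTable, certificateLength])
  refine ⟨c, hlength, fun u => accepts_pathVerifier_iff.2 ?_⟩
  rw [show tableOfBits ∘ c = honestTable G ident φ from funext hc, hc]
  exact check_honestTable hφ u

theorem isBigO_size_log : (fun n : ℕ => (n.size : ℝ)) =O[atTop] fun n : ℕ => Real.log n := by
  have hle (n : ℕ) : (n.size : ℝ) ≤ Real.logb 2 n + 1 := by
    have hsize : n.size ≤ Nat.log 2 n + 1 :=
      Nat.size_le.2 (Nat.lt_pow_succ_log_self one_lt_two n)
    calc (n.size : ℝ) ≤ Nat.log 2 n + 1 := mod_cast hsize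
      _ ≤ Real.logb 2 n + 1 := by gcongr; exact Real.natLog_le_logb n 2
  have hone : (fun _ => 1 : ℝ → ℝ) =O[atTop] Real.log := Real.isLittleO_const_log_atTop.isBigO
  have hlog : (fun x : ℝ => Real.logb 2 x + 1) =O[atTop] Real.log :=
    (Real.isBigO_logb_log.mono le_top).add hone
  have hbound : (fun n : ℕ => (n.size : ℝ)) =O[atTop] fun n : ℕ => Real.logb 2 n + 1 :=
    .of_bound' (.of_forall fun n => (Real.norm_natCast _).trans_le ((hle n).trans (le_abs_self _)))
  exact hbound.trans (hlog.comp_tendsto tendsto_natCast_atTop_atTop)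

theorem isBigO_certificateLength {b : ℕ → ℕ}
    (hb : (fun n => (b n : ℝ)) =O[atTop] fun n : ℕ => Real.log n) :
    (fun n => (certificateLength (b n) n : ℝ)) =O[atTop] fun n : ℕ => (n : ℝ) * Real.log n := by
  have hconst : (fun _ : ℕ => (2 : ℝ)) =O[atTop] fun n : ℕ => Real.log n :=
    Real.isLittleO_const_log_atTop.isBigO.comp_tendsto tendsto_natCast_atTop_atTop
  have hbits := ((hb.add (isBigO_size_log.const_mul_left 6)).const_mul_left 2).add hconst
  refine (hbits.mul ((isBigO_refl (fun n : ℕ => (n : ℝ)) atTop).const_mul_left 5)).congr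
    (fun n => ?_) fun n => mul_comm _ _
  simp only [certificateLength]
  push_cast
  ring

end Scheme

end LocalCert

/-- There is a proof-labeling scheme with locality `1` that certifies `P₅`-freeness with
certificates of size `O(n log n)`. -/
theorem mainTheorem2 :
    LocalCert.HasPLS 1 (fun {V} G => LocalCert.PathFree (V := V) 5 G)
      (fun n : ℕ => (n : ℝ) * Real.log n) := by
  classical
  refine ⟨LocalCert.pathVerifier, fun b hb => ⟨fun n => LocalCert.certificateLength (b n) n,
    LocalCert.isBigO_certificateLength hb, fun V _ G ident hG hinj hident => ?_⟩⟩
  lift ident to V ↪ ℕ using hinj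
  refine ⟨LocalCert.exists_certificates_of_pathFree hG hident, fun hfree c => ?_⟩
  by_contra! haccept
  exact hfree (LocalCert.pathFree_of_forall_check fun u =>
    LocalCert.accepts_pathVerifier_iff.1 (haccept u))
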